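/- Let $(X,\langle\cdot|\cdot\rangle)$ be a non-trivial complex Hilbert space with norm $\|\cdot\|$. Let $A : D(A)\to X$ be a densely defined linear self-adjoint operator in $X$ such that, for some $\varepsilon>0$, $\langle\xi|A\xi\rangle\geqslant\varepsilon\langle\xi|\xi\rangle$ for all $\xi\in D(A)$, and let $A^{1/2}: D(A^{1/2})\to X$ be its square root, i.e. the unique positive self-adjoint operator with $(A^{1/2})^2=A$. Let $B : D(A^{1/2})\to X$ be linear and such that, for some $a\in[0,1)$ and $b\in\mathbb{R}$, $$\|B\xi\|^2\leqslant a^2\|A^{1/2}\xi\|^2+b^2\|\xi\|^2\qquad\text{for all }\xi\in D(A^{1/2}),$$ and assume in addition that $B$ is symmetric or bounded (as an operator in $X$). Let $C : D(A^{1/2})\to X$ be linear and such that, for some $c,d\in\mathbb{R}$, $$\|C\xi\|^2\leqslant c^2\|A^{1/2}\xi\|^2+d^2\|\xi\|^2\qquad\text{for all }\xi\in D(A^{1/2}).$$ Let $W_1$ be the vector space $D(A^{1/2})$ with the norm $\xi\mapsto\|A^{1/2}\xi\|$. Let $t_0\in\mathbb{R}$, $\xi\in D(A)$ and $\eta\in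 D(A^{1/2})$. Then there is exactly one differentiable map $u:\mathbb{R}\to W_1$ with derivative $u':\mathbb{R}\to W_1$ such that $u(t_0)=\xi$ and $u'(t_0)=\eta$, such that $u'$, regarded as a map $\mathbb{R}\to X$, is differentiable, and such that for every $t\in\mathbb{R}$ one has $u(t)\in D(A)$ and $$(u')'(t)+iBu'(t)+(A+C)u(t)=0,$$ where $(u')'$ is the derivative of $u'$ as a map into $X$. -/

import Mathlib

noncomputable section

namespace AbstractWave

open scoped InnerProductSpace

/-! ### Strictly positive self-adjoint operators and their square root -/

section SquareRoot

variable {X : Type*} [NormedAddCommGroup X] [InnerProductSpace ℂ X] [CompleteSpace X]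

/-- The (densely defined) linear operator `A` in `X` is self-adjoint and satisfies
`⟨ξ, A ξ⟩ ≥ ε ⟨ξ, ξ⟩` on its domain for some `ε > 0`. (Self-adjointness of a partially defined
operator includes density of its domain and makes `⟨ξ, A ξ⟩` real.) -/
structure StrictlyPositive (A : X →ₗ.[ℂ] X) : Prop where
  isSelfAdjoint : IsSelfAdjoint A
  exists_bound : ∃ ε : ℝ, 0 < ε ∧ ∀ x : A.domain, ε * ‖(x : X)‖ ^ 2 ≤ (⟪(x : X), A x⟫_ℂ).re

/-- `S` is a positive self-adjoint square root of `A`, i.e. `S ∘ S = A` as partially defined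
operators (equality of domains included). -/
structure IsPositiveSqrt (A S : X →ₗ.[ℂ] X) : Prop where
  isSelfAdjoint : IsSelfAdjoint S
  nonneg : ∀ x : S.domain, 0 ≤ (⟪(x : X), S x⟫_ℂ).re
  mem_domain_iff : ∀ x : X, x ∈ A.domain ↔ ∃ h : x ∈ S.domain, S ⟨x, h⟩ ∈ S.domain
  apply_apply : ∀ (x : X) (hA : x ∈ A.domain) (h : x ∈ S.domain) (h' : S ⟨x, h⟩ ∈ S.domain),
    S ⟨S ⟨x, h⟩, h'⟩ = A ⟨x, hA⟩

theorem symm_of_isSelfAdjoint {T : X →ₗ.[ℂ] X} (hT : IsSelfAdjoint T) (x y : T.domain) :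
    ⟪T x, (y : X)⟫_ℂ = ⟪(x : X), T y⟫_ℂ := by
  have h := LinearPMap.adjoint_isFormalAdjoint hT.dense_domain
  rw [LinearPMap.isSelfAdjoint_def.mp hT] at h
  exact h x y

theorem mem_of_isSelfAdjoint {T : X →ₗ.[ℂ] X} (hT : IsSelfAdjoint T) {y w : X}
    (h : ∀ x : T.domain, ⟪w, (x : X)⟫_ℂ = ⟪y, T x⟫_ℂ) :
    ∃ hy : y ∈ T.domain, T ⟨y, hy⟩ = w := by
  have hy : y ∈ T.adjoint.domain := LinearPMap.mem_adjoint_domain_of_exists y ⟨w, h⟩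
  have hw := LinearPMap.adjoint_apply_eq hT.dense_domain ⟨y, hy⟩ h
  have hg : (y, w) ∈ T.adjoint.graph := by
    rw [LinearPMap.mem_graph_iff]
    exact ⟨⟨y, hy⟩, rfl, hw⟩
  rw [LinearPMap.isSelfAdjoint_def.mp hT, LinearPMap.mem_graph_iff] at hg
  obtain ⟨z, hz, hz'⟩ := hg
  obtain ⟨z, hzd⟩ := z
  simp only at hz hz'
  subst hz
  exact ⟨hzd, hz'⟩

/-- A bijective self-adjoint operator has a bounded symmetric inverse. -/
theorem exists_inverse {T : X →ₗ.[ℂ] X} (hT : IsSelfAdjoint T)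
    (hinj : Function.Injective T) (hsurj : Function.Surjective T) :
    ∃ R : X →L[ℂ] X, (R : X →ₗ[ℂ] X).IsSymmetric ∧
      (∀ y, ∃ h : R y ∈ T.domain, T ⟨R y, h⟩ = y) ∧ ∀ x : T.domain, R (T x) = x := by
  let e : T.domain ≃ₗ[ℂ] X := LinearEquiv.ofBijective T.toFun ⟨hinj, hsurj⟩
  have he : ∀ x, e x = T x := fun x => rfl
  let R₀ : X →ₗ[ℂ] X := T.domain.subtype ∘ₗ e.symm.toLinearMap
  have hT' : ∀ y, T (e.symm y) = y := fun y => by rw [← he, e.apply_symm_apply]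
  have hs : R₀.IsSymmetric := by
    intro x y
    change ⟪((e.symm x : T.domain) : X), y⟫_ℂ = ⟪x, ((e.symm y : T.domain) : X)⟫_ℂ
    conv_lhs => rw [← hT' y]
    conv_rhs => rw [← hT' x]
    exact (symm_of_isSelfAdjoint hT _ _).symm
  refine ⟨⟨R₀, hs.continuous⟩, hs, fun y => ⟨(e.symm y).2, hT' y⟩, fun x => ?_⟩
  change ((e.symm (e x) : T.domain) : X) = x
  rw [e.symm_apply_apply]

theorem StrictlyPositive.injective {A : X →ₗ.[ℂ] X} (hA : StrictlyPositive A) :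
    Function.Injective A := by
  obtain ⟨ε, hε, h⟩ := hA.exists_bound
  refine (injective_iff_map_eq_zero A.toFun).2 fun x hx => ?_
  have hx' : A x = 0 := hx
  have h1 := h x
  rw [hx', inner_zero_right, Complex.zero_re] at h1
  have h2 : ‖(x : X)‖ ^ 2 = 0 := by
    nlinarith [sq_nonneg ‖(x : X)‖]
  simpa using h2

theorem StrictlyPositive.surjective {A : X →ₗ.[ℂ] X} (hA : StrictlyPositive A) :
    Function.Surjective A := by
  obtain ⟨ε, hε, h⟩ := hA.exists_bound
  have hb : ∀ x : A.domain, ε * ‖(x : X)‖ ≤ ‖A x‖ := by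
    intro x
    have h1 : (⟪(x : X), A x⟫_ℂ).re ≤ ‖(x : X)‖ * ‖A x‖ :=
      (Complex.re_le_norm _).trans (norm_inner_le_norm _ _)
    rcases (norm_nonneg (x : X)).eq_or_lt with h0 | h0
    · rw [← h0, mul_zero]; exact norm_nonneg _
    · have := h x
      by_contra! hc
      nlinarith
  have hcl : IsClosed (LinearMap.range A.toFun : Set X) := by
    rw [← isSeqClosed_iff_isClosed]
    intro y z hy hyz
    choose x hx using hy
    have hx' : ∀ n, A (x n) = y n := hx
    have hc : CauchySeq fun n => ((x n : A.domain) : X) := by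
      have hyc := hyz.cauchySeq
      rw [Metric.cauchySeq_iff] at hyc ⊢
      intro δ hδ
      obtain ⟨N, hN⟩ := hyc (ε * δ) (by positivity)
      refine ⟨N, fun m hm n hn => ?_⟩
      have h1 := hN m hm n hn
      have h2 := hb (x m - x n)
      rw [LinearPMap.map_sub, hx', hx', ← dist_eq_norm] at h2
      have h3 : ‖((x m - x n : A.domain) : X)‖ = dist (x m : X) (x n) := by
        rw [dist_eq_norm]; rfl
      rw [h3] at h2
      exact lt_of_mul_lt_mul_left (h2.trans_lt h1) hε.le
    obtain ⟨l, hl⟩ := cauchySeq_tendsto_of_complete hc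
    have hg : (l, z) ∈ (A.graph : Set (X × X)) := by
      refine (hA.isSelfAdjoint.isClosed : IsClosed (A.graph : Set (X × X))).mem_of_tendsto
        (hl.prodMk_nhds hyz) (Filter.Eventually.of_forall fun n => ?_)
      rw [← hx' n]
      exact LinearPMap.mem_graph A (x n)
    rw [SetLike.mem_coe, LinearPMap.mem_graph_iff] at hg
    obtain ⟨w, -, hw⟩ := hg
    exact ⟨w, hw⟩
  have : CompleteSpace (LinearMap.range A.toFun) := hcl.completeSpace_coe
  have htop : LinearMap.range A.toFun = ⊤ := by
    rw [← Submodule.orthogonal_eq_bot_iff, Submodule.eq_bot_iff]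
    intro y hy
    obtain ⟨hyd, hy0⟩ := mem_of_isSelfAdjoint hA.isSelfAdjoint (y := y) (w := 0) fun x => by
      rw [inner_zero_left]
      exact ((Submodule.mem_orthogonal' _ _).1 hy _ ⟨x, rfl⟩).symm
    have h0 : A ⟨y, hyd⟩ = A 0 := by rw [hy0, LinearPMap.map_zero]
    simpa using congrArg (fun v : A.domain => (v : X)) (hA.injective h0)
  exact LinearMap.range_eq_top.1 htop

theorem IsPositiveSqrt.injective {A S : X →ₗ.[ℂ] X} (hA : StrictlyPositive A)
    (hS : IsPositiveSqrt A S) : Function.Injective S := by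
  refine (injective_iff_map_eq_zero S.toFun).2 fun x hx => ?_
  have hx' : S ⟨x, x.2⟩ = 0 := hx
  have hm : S ⟨x, x.2⟩ ∈ S.domain := hx' ▸ S.domain.zero_mem
  have hxA : (x : X) ∈ A.domain := (hS.mem_domain_iff x).2 ⟨x.2, hm⟩
  have h0 : A ⟨x, hxA⟩ = A 0 := by
    rw [← hS.apply_apply x hxA x.2 hm, LinearPMap.map_zero]
    have : (⟨S ⟨x, x.2⟩, hm⟩ : S.domain) = 0 := Subtype.ext hx'
    rw [this, LinearPMap.map_zero]
  have := congrArg (fun v : A.domain => (v : X)) (hA.injective h0)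
  exact Subtype.ext this

theorem IsPositiveSqrt.surjective {A S : X →ₗ.[ℂ] X} (hA : StrictlyPositive A)
    (hS : IsPositiveSqrt A S) : Function.Surjective S := by
  intro y
  obtain ⟨x, rfl⟩ := hA.surjective y
  obtain ⟨h, h'⟩ := (hS.mem_domain_iff x).1 x.2
  exact ⟨⟨_, h'⟩, hS.apply_apply x x.2 h h'⟩

/-- The inverse of an injective bounded operator, as a partially defined operator. -/
def invPMap (Q : X →L[ℂ] X) (hQ : Function.Injective (Q : X →ₗ[ℂ] X)) : X →ₗ.[ℂ] X where
  domain := LinearMap.range (Q : X →ₗ[ℂ] X)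
  toFun := (LinearEquiv.ofInjective (Q : X →ₗ[ℂ] X) hQ).symm.toLinearMap

theorem invPMap_apply (Q : X →L[ℂ] X) (hQ : Function.Injective (Q : X →ₗ[ℂ] X)) (z : X)
    (h : Q z ∈ (invPMap Q hQ).domain) : invPMap Q hQ ⟨Q z, h⟩ = z :=
  hQ (LinearEquiv.ofInjective_symm_apply (f := (Q : X →ₗ[ℂ] X)) (h := hQ) ⟨Q z, h⟩)

theorem mem_invPMap (Q : X →L[ℂ] X) (hQ : Function.Injective (Q : X →ₗ[ℂ] X)) (z : X) :
    Q z ∈ (invPMap Q hQ).domain := ⟨z, rfl⟩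

theorem isSelfAdjoint_invPMap (Q : X →L[ℂ] X) (hQ : Function.Injective (Q : X →ₗ[ℂ] X))
    (hs : (Q : X →ₗ[ℂ] X).IsSymmetric) : IsSelfAdjoint (invPMap Q hQ) := by
  have hd : Dense ((invPMap Q hQ).domain : Set X) := by
    rw [Submodule.dense_iff_topologicalClosure_eq_top, Submodule.topologicalClosure_eq_top_iff,
      Submodule.eq_bot_iff]
    intro y hy
    apply hQ
    rw [map_zero]
    refine ext_inner_right ℂ fun v => ?_
    rw [inner_zero_left]
    exact (hs y v).trans ((Submodule.mem_orthogonal' _ _).1 hy _ ⟨v, rfl⟩)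
  rw [LinearPMap.isSelfAdjoint_def]
  symm
  refine LinearPMap.eq_of_le_of_domain_eq (LinearPMap.IsFormalAdjoint.le_adjoint hd ?_) ?_
  · rintro ⟨_, z, rfl⟩ ⟨_, w, rfl⟩
    exact (congrArg₂ _ (invPMap_apply Q hQ z ⟨z, rfl⟩) rfl).trans
      ((hs z w).symm.trans (congrArg₂ _ rfl (invPMap_apply Q hQ w ⟨w, rfl⟩).symm))
  · refine le_antisymm (LinearPMap.IsFormalAdjoint.le_adjoint hd ?_).1 fun y hy => ?_
    · rintro ⟨_, z, rfl⟩ ⟨_, w, rfl⟩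
      exact (congrArg₂ _ (invPMap_apply Q hQ z ⟨z, rfl⟩) rfl).trans
        ((hs z w).symm.trans (congrArg₂ _ rfl (invPMap_apply Q hQ w ⟨w, rfl⟩).symm))
    · refine ⟨(invPMap Q hQ).adjoint ⟨y, hy⟩, ?_⟩
      refine ext_inner_right ℂ fun v => ?_
      refine (hs _ v).trans ?_
      have := LinearPMap.adjoint_isFormalAdjoint hd ⟨y, hy⟩ ⟨Q v, v, rfl⟩
      exact this.trans (congrArg (fun w => ⟪y, w⟫_ℂ) (invPMap_apply Q hQ v ⟨v, rfl⟩))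

/-- A strictly positive self-adjoint operator has exactly one positive self-adjoint square
root. -/
theorem existsUnique_isPositiveSqrt {A : X →ₗ.[ℂ] X} (hA : StrictlyPositive A) :
    ∃! S : X →ₗ.[ℂ] X, IsPositiveSqrt A S := by
  obtain ⟨R, hRs, hR, hR'⟩ := exists_inverse hA.isSelfAdjoint hA.injective hA.surjective
  have hRinj : ∀ x, R x = 0 → x = 0 := by
    intro x hx
    obtain ⟨h, h'⟩ := hR x
    rw [← h']
    have : (⟨R x, h⟩ : A.domain) = 0 := Subtype.ext hx
    rw [this, LinearPMap.map_zero]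
  have hRpos : 0 ≤ R := by
    rw [ContinuousLinearMap.nonneg_iff_isPositive, ContinuousLinearMap.isPositive_iff]
    refine ⟨hRs, fun x => ?_⟩
    obtain ⟨ε, hε, hb⟩ := hA.exists_bound
    obtain ⟨h, h'⟩ := hR x
    have h1 := hb ⟨R x, h⟩
    rw [h'] at h1
    have h2 : 0 ≤ (⟪R x, x⟫_ℂ).re := le_trans (by positivity) h1
    rw [Complex.le_def]
    refine ⟨h2, ?_⟩
    have h3 := hRs.coe_re_inner_apply_self x
    have h4 := congrArg Complex.im h3
    simpa using h4
  refine existsUnique_of_exists_of_unique ?_ ?_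
  · set Q : X →L[ℂ] X := CFC.sqrt R with hQdef
    have hQQ : ∀ x, Q (Q x) = R x := fun x =>
      congrArg (fun f : X →L[ℂ] X => f x) (CFC.sqrt_mul_sqrt_self R hRpos)
    have hQpos : Q.IsPositive :=
      (ContinuousLinearMap.nonneg_iff_isPositive Q).1 (CFC.sqrt_nonneg R)
    have hQs : (Q : X →ₗ[ℂ] X).IsSymmetric := hQpos.isSymmetric
    have hQinj : Function.Injective (Q : X →ₗ[ℂ] X) := by
      refine (injective_iff_map_eq_zero _).2 fun x hx => hRinj x ?_
      have hx' : Q x = 0 := hx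
      rw [← hQQ, hx', map_zero]
    refine ⟨invPMap Q hQinj, isSelfAdjoint_invPMap Q hQinj hQs, ?_, ?_, ?_⟩
    · rintro ⟨_, z, rfl⟩
      have := hQpos.re_inner_nonneg_left z
      exact this.trans_eq (congrArg (fun v => (⟪Q z, v⟫_ℂ).re)
        (invPMap_apply Q hQinj z ⟨z, rfl⟩).symm)
    · intro x
      constructor
      · intro hx
        have h1 : Q (Q (A ⟨x, hx⟩)) = x := by rw [hQQ, hR']
        have h2 : x ∈ (invPMap Q hQinj).domain := ⟨_, h1⟩
        refine ⟨h2, ?_⟩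
        have h3 : (⟨x, h2⟩ : (invPMap Q hQinj).domain) = ⟨Q (Q (A ⟨x, hx⟩)), mem_invPMap _ _ _⟩ :=
          Subtype.ext h1.symm
        rw [h3, invPMap_apply]
        exact mem_invPMap _ _ _
      · rintro ⟨⟨z, rfl⟩, h⟩
        have h1 : invPMap Q hQinj ⟨Q z, mem_invPMap _ _ _⟩ ∈ (invPMap Q hQinj).domain := h
        rw [invPMap_apply] at h1
        obtain ⟨w, rfl⟩ := h1
        change Q (Q w) ∈ A.domain
        rw [hQQ]
        exact (hR w).1
    · intro x hx h h'
      have h1 : Q (Q (A ⟨x, hx⟩)) = x := by rw [hQQ, hR']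
      have h3 : (⟨x, h⟩ : (invPMap Q hQinj).domain) = ⟨Q (Q (A ⟨x, hx⟩)), mem_invPMap _ _ _⟩ :=
        Subtype.ext h1.symm
      have h4 : (⟨invPMap Q hQinj ⟨x, h⟩, h'⟩ : (invPMap Q hQinj).domain) =
          ⟨Q (A ⟨x, hx⟩), mem_invPMap _ _ _⟩ := by
        apply Subtype.ext
        change invPMap Q hQinj ⟨x, h⟩ = _
        rw [h3, invPMap_apply]
      rw [h4, invPMap_apply]
  · have key : ∀ S : X →ₗ.[ℂ] X, IsPositiveSqrt A S →
        ∀ y w : X, (y, w) ∈ S.graph ↔ CFC.sqrt R w = y := by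
      intro S hS y w
      obtain ⟨P, hPs, hP, hP'⟩ :=
        exists_inverse hS.isSelfAdjoint (hS.injective hA) (hS.surjective hA)
      have hPP : P * P = R := by
        ext z
        change P (P z) = R z
        obtain ⟨h, h'⟩ := hR z
        obtain ⟨hs, hs'⟩ := (hS.mem_domain_iff _).1 h
        have h1 := hS.apply_apply _ h hs hs'
        rw [h'] at h1
        rw [← h1]
        rw [hP' ⟨_, hs'⟩, hP' ⟨_, hs⟩, h1]
      have hPpos : 0 ≤ P := by
        rw [ContinuousLinearMap.nonneg_iff_isPositive, ContinuousLinearMap.isPositive_iff]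
        refine ⟨hPs, fun x => ?_⟩
        obtain ⟨h, h'⟩ := hP x
        have h1 := hS.nonneg ⟨P x, h⟩
        rw [h'] at h1
        rw [Complex.le_def]
        refine ⟨h1, ?_⟩
        have h3 := hPs.coe_re_inner_apply_self x
        have h4 := congrArg Complex.im h3
        simpa using h4
      rw [CFC.sqrt_unique hPP hPpos, LinearPMap.mem_graph_iff]
      constructor
      · rintro ⟨z, rfl, rfl⟩
        exact hP' z
      · rintro rfl
        obtain ⟨h, h'⟩ := hP w
        exact ⟨⟨_, h⟩, rfl, h'⟩
    intro S S' hS hS'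
    apply LinearPMap.eq_of_eq_graph
    ext ⟨y, w⟩
    rw [key S hS, key S' hS']

/-- The square root `A^{1/2}` of a strictly positive self-adjoint operator `A`: the unique positive
self-adjoint operator with square `A`. -/
def sqrt (A : X →ₗ.[ℂ] X) (hA : StrictlyPositive A) : X →ₗ.[ℂ] X :=
  (existsUnique_isPositiveSqrt hA).choose

theorem sqrt_spec (A : X →ₗ.[ℂ] X) (hA : StrictlyPositive A) : IsPositiveSqrt A (sqrt A hA) :=
  (existsUnique_isPositiveSqrt hA).choose_spec.1

end SquareRoot

/-! ### The space `W₁ = (D(A^{1/2}), ‖A^{1/2} ·‖)` -/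

section EnergySpace

variable {X : Type*} [NormedAddCommGroup X] [InnerProductSpace ℂ X] [CompleteSpace X]

/-- The vector space `D(A^{1/2})`, as a separate type that carries the norm `ξ ↦ ‖A^{1/2} ξ‖`
instead of the norm of `X`. -/
def EnergySpace (A : X →ₗ.[ℂ] X) (hA : StrictlyPositive A) : Type _ := (sqrt A hA).domain

namespace EnergySpace

variable {A : X →ₗ.[ℂ] X} {hA : StrictlyPositive A}

instance instAddCommGroup : AddCommGroup (EnergySpace A hA) :=
  inferInstanceAs (AddCommGroup (sqrt A hA).domain)

instance instModule : Module ℂ (EnergySpace A hA) :=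
  inferInstanceAs (Module ℂ (sqrt A hA).domain)

/-- The operator `A^{1/2}`, as a linear map on the whole of `D(A^{1/2})`. -/
def sqrtMap : EnergySpace A hA →ₗ[ℂ] X := (sqrt A hA).toFun

/-- The inclusion of `D(A^{1/2})` into `X`. -/
def toX : EnergySpace A hA →ₗ[ℂ] X := (sqrt A hA).domain.subtype

instance instNormedAddCommGroup : NormedAddCommGroup (EnergySpace A hA) :=
  NormedAddCommGroup.induced (EnergySpace A hA) X (sqrtMap (A := A) (hA := hA))
    ((sqrt_spec A hA).injective hA)

instance instNormedSpace : NormedSpace ℂ (EnergySpace A hA) :=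
  NormedSpace.induced ℂ (EnergySpace A hA) X (sqrtMap (A := A) (hA := hA))

theorem norm_def (x : EnergySpace A hA) : ‖x‖ = ‖sqrtMap x‖ := rfl

end EnergySpace

end EnergySpace

end AbstractWave

end

noncomputable section

namespace AbstractWave

open scoped InnerProductSpace
open Filter Topology NormedSpace

/-! ### Energy estimates and strong limits of exponentials of bounded operators. -/

section Flow

variable {H : Type*} [NormedAddCommGroup H] [InnerProductSpace ℂ H]

/-! Write `S` for the square root of `A`. Since `A` is strictly positive, `S` has a bounded
symmetric inverse `P` with dense range, and `B' = B P`, `C' = C P` are bounded on `X`. With `w = (A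
u, S u')` in `X ⊕ X` one has `(P ⊕ P) w = (S u, u')`, and the wave equation becomes the first order
system `(D w)' = L w`, where `D = P ⊕ P` and `L (a, b) = (b, -a - i B' b - C' P a)`. So the
unbounded generator `G = L D⁻¹` on the energy space is encoded by a pencil of two bounded operators,
and no domains occur until the translation back.

Two facts about the pencil carry the proof. The energy bound `|Re ⟪L w, D w⟫| ≤ ω ‖D w‖²` holds
because the principal part contributes nothing, `C'` is bounded, and `B` contributes nothing if
symmetric and a bounded term if bounded (`abs_re_inner_wave_le`). The operator `μ D - L` is
invertible for large real `|μ|`, because the principal part is and the rest is a relatively small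
perturbation, where `a < 1` enters (`isUnit_wave_pencil`).

Uniqueness follows from the energy bound by a Gronwall argument. Existence is a Hille–Yosida
argument for groups (`exists_flow_of_isUnit_pencil`). Instead of the usual Yosida approximation it
uses `μ² G (μ² - G²)⁻¹`, whose numerical real part is bounded on both sides uniformly in `μ`, so
both time directions are handled at once. These bounded approximations commute, and their
exponentials converge locally uniformly in time. -/

theorem hasDerivAt_norm_sq {f : ℝ → H} {f' : H} {t : ℝ} (hf : HasDerivAt f f' t) :
    HasDerivAt (fun s => ‖f s‖ ^ 2) (2 * (⟪f', f t⟫_ℂ).re) t := by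
  let _ : InnerProductSpace ℝ H := InnerProductSpace.complexToReal
  have h := hf.norm_sq
  rw [real_inner_comm, real_inner_eq_re_inner ℂ] at h
  exact h

/-- Energy estimate, forward in time. -/
theorem norm_le_exp_mul_of_re_inner_le {f f' : ℝ → H} {K : ℝ}
    (hf : ∀ t, HasDerivAt f (f' t) t) (h : ∀ t, (⟪f' t, f t⟫_ℂ).re ≤ K * ‖f t‖ ^ 2)
    {t : ℝ} (ht : 0 ≤ t) : ‖f t‖ ≤ Real.exp (K * t) * ‖f 0‖ := by
  -- Gronwall: the weighted energy `e^{-2Ks} ‖f s‖²` is nonincreasing.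
  have hg : ∀ s, HasDerivAt (fun s => Real.exp (-(2 * K) * s) * ‖f s‖ ^ 2)
      (Real.exp (-(2 * K) * s) * (-(2 * K)) * ‖f s‖ ^ 2 +
        Real.exp (-(2 * K) * s) * (2 * (⟪f' s, f s⟫_ℂ).re)) s := fun s => by
    have h1 : HasDerivAt (fun s : ℝ => -(2 * K) * s) (-(2 * K)) s := by
      simpa using (hasDerivAt_id s).const_mul (-(2 * K))
    exact h1.exp.mul (hasDerivAt_norm_sq (hf s))
  have ha := antitone_of_hasDerivAt_nonpos hg (fun s => by
    have h1 : 0 ≤ Real.exp (-(2 * K) * s) * (2 * (K * ‖f s‖ ^ 2 - (⟪f' s, f s⟫_ℂ).re)) := by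
      have := h s
      have := sub_nonneg.2 this
      positivity
    change _ ≤ (0 : ℝ)
    linarith) ht
  simp only [mul_zero, Real.exp_zero, one_mul] at ha
  have h2 : ‖f t‖ ^ 2 ≤ (Real.exp (K * t) * ‖f 0‖) ^ 2 := by
    have h3 : Real.exp (K * t) ^ 2 * Real.exp (-(2 * K) * t) = 1 := by
      rw [← Real.exp_nat_mul, ← Real.exp_add]
      convert Real.exp_zero using 2
      push_cast; ring
    calc ‖f t‖ ^ 2 = Real.exp (K * t) ^ 2 * (Real.exp (-(2 * K) * t) * ‖f t‖ ^ 2) := by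
          rw [← mul_assoc, h3, one_mul]
      _ ≤ Real.exp (K * t) ^ 2 * ‖f 0‖ ^ 2 := by gcongr
      _ = _ := by ring
  exact (sq_le_sq₀ (norm_nonneg _) (by positivity)).1 h2

/-- Energy estimate in both time directions. -/
theorem norm_le_exp_abs_mul_of_abs_re_inner_le {f f' : ℝ → H} {K : ℝ}
    (hf : ∀ t, HasDerivAt f (f' t) t) (h : ∀ t, |(⟪f' t, f t⟫_ℂ).re| ≤ K * ‖f t‖ ^ 2)
    (t : ℝ) : ‖f t‖ ≤ Real.exp (K * |t|) * ‖f 0‖ := by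
  rcases le_total 0 t with ht | ht
  · rw [abs_of_nonneg ht]
    exact norm_le_exp_mul_of_re_inner_le hf (fun s => (le_abs_self _).trans (h s)) ht
  · have h1 : ∀ s, HasDerivAt (fun s => f (-s)) (-f' (-s)) s := fun s => by
      simpa [Function.comp_def] using (hf (-s)).scomp s (hasDerivAt_neg s)
    have h2 := norm_le_exp_mul_of_re_inner_le (K := K) h1 (fun s => by
      rw [inner_neg_left, Complex.neg_re]
      exact (neg_le_abs _).trans (h (-s))) (neg_nonneg.2 ht)
    rw [abs_of_nonpos ht]
    simpa using h2

variable [CompleteSpace H]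

theorem hasDerivAt_exp_smul_apply (M : H →L[ℂ] H) (x : H) (t : ℝ) :
    HasDerivAt (fun s : ℝ => exp (s • M) x) (M (exp (t • M) x)) t := by
  have h := hasDerivAt_exp_smul_const' (𝕂 := ℝ) M t
  exact (((ContinuousLinearMap.apply ℂ H x).restrictScalars ℝ).hasFDerivAt).comp_hasDerivAt t h

theorem norm_exp_smul_apply_le {M : H →L[ℂ] H} {K : ℝ}
    (hM : ∀ x, |(⟪M x, x⟫_ℂ).re| ≤ K * ‖x‖ ^ 2) (x : H) (t : ℝ) :
    ‖exp (t • M) x‖ ≤ Real.exp (K * |t|) * ‖x‖ := by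
  simpa using norm_le_exp_abs_mul_of_abs_re_inner_le (hasDerivAt_exp_smul_apply M x)
    (fun t => hM _) t

theorem commute_exp_smul {M N : H →L[ℂ] H} (h : Commute M N) (t : ℝ) :
    Commute M (exp (t • N)) := by
  exact (h.smul_right t).exp_right

/-- Mean value inequality: the derivative of the orbit is `exp (s M) (M x)`, which is controlled by
`‖M x‖` and the numerical bound `K` but not by `‖M‖`. This keeps the estimate uniform along the
approximations, whose norms may blow up. -/
theorem norm_exp_smul_apply_sub_self_le {M : H →L[ℂ] H} {K : ℝ} (hK : 0 ≤ K)
    (hM : ∀ x, |(⟪M x, x⟫_ℂ).re| ≤ K * ‖x‖ ^ 2) (x : H) (t : ℝ) :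
    ‖exp (t • M) x - x‖ ≤ Real.exp (K * |t|) * |t| * ‖M x‖ := by
  have h := (convex_uIcc (0 : ℝ) t).norm_image_sub_le_of_norm_hasDerivWithin_le
    (C := Real.exp (K * |t|) * ‖M x‖)
    (fun s _ => (hasDerivAt_exp_smul_apply M x s).hasDerivWithinAt) (fun s hs => by
      have hc : M (exp (s • M) x) = exp (s • M) (M x) :=
        congrArg (fun f : H →L[ℂ] H => f x) (commute_exp_smul (Commute.refl M) s).eq
      rw [hc]
      refine (norm_exp_smul_apply_le hM _ s).trans ?_
      have : |s| ≤ |t| := by simpa using Set.abs_sub_left_of_mem_uIcc hs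
      gcongr) Set.left_mem_uIcc Set.right_mem_uIcc
  simp only [zero_smul, exp_zero, sub_zero, Real.norm_eq_abs,
    one_apply_eq_self] at h
  linarith

/-- By commutativity `exp (tM) - exp (tN) = exp (tN) (exp (t(M - N)) - 1)`, and `M - N` has
numerical bound `2K`. Strong convergence of the generators at a vector thus yields convergence of
the orbits of that vector. -/
theorem norm_exp_smul_apply_sub_le {M N : H →L[ℂ] H} (hc : Commute M N) {K : ℝ} (hK : 0 ≤ K)
    (hM : ∀ x, |(⟪M x, x⟫_ℂ).re| ≤ K * ‖x‖ ^ 2) (hN : ∀ x, |(⟪N x, x⟫_ℂ).re| ≤ K * ‖x‖ ^ 2)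
    (x : H) (t : ℝ) :
    ‖exp (t • M) x - exp (t • N) x‖ ≤
      Real.exp (K * |t|) * (Real.exp (2 * K * |t|) * |t|) * ‖M x - N x‖ := by
  have h1 : exp (t • M) = exp (t • N) * exp (t • (M - N)) := by
    let _ : NormedAlgebra ℚ (H →L[ℂ] H) := NormedAlgebra.restrictScalars ℚ ℝ _
    rw [← exp_add_of_commute]
    · rw [← smul_add, add_sub_cancel]
    · exact ((hc.symm.sub_right (Commute.refl N)).smul_left t).smul_right t
  have h2 : exp (t • M) x - exp (t • N) x = exp (t • N) (exp (t • (M - N)) x - x) := by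
    rw [map_sub, h1]; rfl
  have h3 : ∀ x, |(⟪(M - N) x, x⟫_ℂ).re| ≤ 2 * K * ‖x‖ ^ 2 := fun x => by
    rw [_root_.sub_apply, inner_sub_left, Complex.sub_re]
    have := abs_sub (⟪M x, x⟫_ℂ).re (⟪N x, x⟫_ℂ).re
    linarith [hM x, hN x]
  rw [h2, mul_assoc]
  refine (norm_exp_smul_apply_le hN _ t).trans ?_
  have := norm_exp_smul_apply_sub_self_le (by positivity) h3 x t
  rw [_root_.sub_apply] at this
  gcongr

/-- Strong limits of uniformly bounded operators on a dense range extend to the whole space. -/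
theorem tendsto_of_denseRange {A : ℕ → H →L[ℂ] H} {C : ℝ} (hA : ∀ n x, ‖A n x‖ ≤ C * ‖x‖)
    {R : H →L[ℂ] H} (hR : DenseRange R)
    (h : ∀ y, Tendsto (fun n => A n (R y)) atTop (𝓝 (R y))) (x : H) :
    Tendsto (fun n => A n x) atTop (𝓝 x) := by
  have hC : 0 < |C| + 2 := by positivity
  rw [Metric.tendsto_atTop]
  intro ε hε
  obtain ⟨y, hy⟩ := hR.exists_dist_lt x (show 0 < ε / (2 * (|C| + 2)) by positivity)
  rw [lt_div_iff₀ (by positivity), dist_eq_norm] at hy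
  obtain ⟨N, hN⟩ := Metric.tendsto_atTop.1 (h y) (ε / (|C| + 2)) (by positivity)
  refine ⟨N, fun n hn => ?_⟩
  have h1 := hN n hn
  rw [dist_eq_norm] at h1
  rw [dist_eq_norm]
  have h2 : A n x - x = A n (x - R y) + (A n (R y) - R y) - (x - R y) := by
    rw [map_sub]; abel
  have h3 : ‖A n (x - R y)‖ ≤ |C| * ‖x - R y‖ := (hA n _).trans (by gcongr; exact le_abs_self C)
  have h4 : ‖A n x - x‖ ≤ ‖A n (x - R y)‖ + ‖A n (R y) - R y‖ + ‖x - R y‖ := by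
    rw [h2]
    exact (norm_sub_le _ _).trans (by gcongr; exact norm_add_le _ _)
  have h5 : ε / (|C| + 2) ≤ ε / 2 := by
    gcongr; linarith [abs_nonneg C]
  have h6 : 0 ≤ |C| * ‖x - R y‖ := by positivity
  linarith [norm_nonneg (x - R y)]

theorem uniformCauchySeqOn_exp {M : ℕ → H →L[ℂ] H} (hM : ∀ m n, Commute (M m) (M n)) {K : ℝ}
    (hK : 0 ≤ K) (hb : ∀ n x, |(⟪M n x, x⟫_ℂ).re| ≤ K * ‖x‖ ^ 2) {R : H →L[ℂ] H}
    (hR : DenseRange R) {T : H →L[ℂ] H}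
    (hT : ∀ y, Tendsto (fun n => M n (R y)) atTop (𝓝 (T y))) (x : H) (r : ℝ) :
    UniformCauchySeqOn (fun n (t : ℝ) => exp (t • M n) x) atTop (Set.Ioo (-r) r) := by
  rw [Metric.uniformCauchySeqOn_iff]
  intro ε hε
  set c := Real.exp (K * r) with hc
  -- The summand `1` only makes `c'` positive, so that one can divide by it.
  set c' := Real.exp (K * r) * (Real.exp (2 * K * r) * |r|) + 1 with hc'
  have hcp : 0 < c := Real.exp_pos _
  have hcp' : 0 < c' := by positivity
  obtain ⟨y, hy⟩ := hR.exists_dist_lt x (show 0 < ε / (4 * c) by positivity)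
  rw [lt_div_iff₀ (by positivity), dist_eq_norm] at hy
  obtain ⟨N, hN⟩ := Metric.cauchySeq_iff.1 (hT y).cauchySeq (ε / (2 * c')) (by positivity)
  refine ⟨N, fun m hm n hn t ht => ?_⟩
  have htr : |t| ≤ r := (abs_lt.2 ht).le
  have h1 := hN m hm n hn
  rw [dist_eq_norm, lt_div_iff₀ (by positivity)] at h1
  rw [dist_eq_norm]
  have h2 : exp (t • M m) x - exp (t • M n) x = exp (t • M m) (x - R y) +
      (exp (t • M m) (R y) - exp (t • M n) (R y)) - exp (t • M n) (x - R y) := by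
    rw [map_sub, map_sub]; abel
  have h3 : ∀ n, ‖exp (t • M n) (x - R y)‖ ≤ c * ‖x - R y‖ := fun n =>
    (norm_exp_smul_apply_le (hb n) _ t).trans (by rw [hc]; gcongr)
  have h4 : ‖exp (t • M m) (R y) - exp (t • M n) (R y)‖ ≤ c' * ‖M m (R y) - M n (R y)‖ := by
    refine (norm_exp_smul_apply_sub_le (hM m n) hK (hb m) (hb n) _ t).trans ?_
    gcongr
    refine le_trans ?_ (le_add_of_nonneg_right zero_le_one)
    have := htr.trans (le_abs_self r)
    gcongr
  have h5 : ‖exp (t • M m) x - exp (t • M n) x‖ ≤ ‖exp (t • M m) (x - R y)‖ +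
      ‖exp (t • M m) (R y) - exp (t • M n) (R y)‖ + ‖exp (t • M n) (x - R y)‖ := by
    rw [h2]
    exact (norm_sub_le _ _).trans (by gcongr; exact norm_add_le _ _)
  linarith [h3 m, h3 n]

/-- The exponentials of commuting bounded operators `M n`, with uniformly bounded numerical real
parts, that converge strongly to `T ∘ R⁻¹` on the range of `R`, converge to the flow of
`T ∘ R⁻¹`. -/
theorem exists_flow_of_tendsto {M : ℕ → H →L[ℂ] H} (hM : ∀ m n, Commute (M m) (M n)) {K : ℝ}
    (hK : 0 ≤ K) (hb : ∀ n x, |(⟪M n x, x⟫_ℂ).re| ≤ K * ‖x‖ ^ 2) {R : H →L[ℂ] H}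
    (hR : DenseRange R) (hMR : ∀ n, Commute (M n) R) {T : H →L[ℂ] H}
    (hMT : ∀ n, Commute (M n) T)
    (hT : ∀ y, Tendsto (fun n => M n (R y)) atTop (𝓝 (T y))) (x : H) :
    ∃ w : ℝ → H, w 0 = x ∧ ∀ t, HasDerivAt (fun s => R (w s)) (T (w t)) t := by
  have hu := fun r => uniformCauchySeqOn_exp hM hK hb hR hT x r
  have hlim : ∀ t : ℝ, ∃ z, Tendsto (fun n => exp (t • M n) x) atTop (𝓝 z) := fun t =>
    cauchySeq_tendsto_of_complete ((hu (|t| + 1)).cauchySeq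
      (abs_lt.1 (lt_add_one |t|)))
  choose w hw using hlim
  have hcm : ∀ {N : H →L[ℂ] H} (n) (t : ℝ), Commute (M n) N → ∀ y,
      N (exp (t • M n) y) = exp (t • M n) (N y) := fun n t h y =>
    congrArg (fun f : H →L[ℂ] H => f y) (commute_exp_smul h.symm t).eq
  refine ⟨w, ?_, fun t => ?_⟩
  · refine tendsto_nhds_unique (hw 0) ?_
    simp
  have ht : t ∈ Set.Ioo (-(|t| + 1)) (|t| + 1) := abs_lt.1 (lt_add_one |t|)
  set r := |t| + 1
  have hunif : TendstoUniformlyOn (fun n (s : ℝ) => exp (s • M n) x) w atTop (Set.Ioo (-r) r) :=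
    (hu r).tendstoUniformlyOn_of_tendsto fun s _ => hw s
  -- The derivatives `exp (s M_n) (M_n R x)` are uniformly close to `exp (s M_n) (T x) = T (exp (s
  -- M_n) x)`, which tends uniformly to `T (w s)`.
  refine hasDerivAt_of_tendstoUniformlyOn (l := atTop) (g := fun s => R (w s))
    (g' := fun s => T (w s))
    (f := fun n s => R (exp (s • M n) x)) (f' := fun n s => exp (s • M n) (M n (R x)))
    isOpen_Ioo ?_ (Eventually.of_forall fun n s _ => ?_) (fun s _ => ?_) ht
  · rw [Metric.tendstoUniformlyOn_iff]
    intro ε hε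
    have h1 := T.uniformContinuous.comp_tendstoUniformlyOn hunif
    rw [Metric.tendstoUniformlyOn_iff] at h1
    have h2 := Metric.tendsto_nhds.1 (hT x) (ε / 2 / Real.exp (K * r)) (by positivity)
    filter_upwards [h1 (ε / 2) (by positivity), h2] with n hn1 hn2 s hs
    have h3 := hn1 s hs
    simp only [Function.comp_apply] at h3
    rw [hcm n s (hMT n)] at h3
    rw [lt_div_iff₀ (Real.exp_pos _), dist_eq_norm] at hn2
    have h4 : dist (exp (s • M n) (T x)) (exp (s • M n) (M n (R x))) < ε / 2 := by
      rw [dist_comm, dist_eq_norm, ← map_sub]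
      refine ((norm_exp_smul_apply_le (hb n) _ s).trans ?_).trans_lt hn2
      rw [mul_comm]
      gcongr
      exact (abs_lt.2 hs).le
    linarith [dist_triangle (T (w s)) (exp (s • M n) (T x)) (exp (s • M n) (M n (R x)))]
  · have h := hasDerivAt_exp_smul_apply (M n) (R x) s
    rw [hcm n s (Commute.refl _)] at h
    simpa only [hcm n _ (hMR n)] using h
  · exact (R.continuous.tendsto _).comp (hw s)

end Flow
end AbstractWave

namespace AbstractWave

open scoped InnerProductSpace
open Filter Topology NormedSpace

/-! ### Generation of a group by an operator pencil. -/

section Pencil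

variable {H : Type*} [NormedAddCommGroup H] [InnerProductSpace ℂ H] {P L : H →L[ℂ] H}

/-- The inverse of the pencil `μ P - L`. -/
def pencilInv (P L : H →L[ℂ] H) (μ : ℝ) : H →L[ℂ] H := Ring.inverse ((μ : ℂ) • P - L)

/-- The resolvent `(μ - L P⁻¹)⁻¹` at real `μ`, written without the inverse of `P`. -/
def pencilRes (P L : H →L[ℂ] H) (μ : ℝ) : H →L[ℂ] H := P * pencilInv P L μ

theorem pencilRes_apply (μ : ℝ) (x : H) : pencilRes P L μ x = P (pencilInv P L μ x) := rfl

theorem apply_pencilInv {μ : ℝ} (h : IsUnit ((μ : ℂ) • P - L)) (x : H) :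
    L (pencilInv P L μ x) = (μ : ℂ) • pencilRes P L μ x - x := by
  have h1 : (μ : ℂ) • P (pencilInv P L μ x) - L (pencilInv P L μ x) = x :=
    congrArg (fun f : H →L[ℂ] H => f x) (Ring.mul_inverse_cancel _ h)
  rw [pencilRes_apply, eq_sub_iff_add_eq, ← eq_sub_iff_add_eq', h1]

theorem pencilInv_apply_sub {μ : ℝ} (h : IsUnit ((μ : ℂ) • P - L)) (w : H) :
    pencilInv P L μ ((μ : ℂ) • P w - L w) = w :=
  congrArg (fun f : H →L[ℂ] H => f w) (Ring.inverse_mul_cancel _ h)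

theorem pencilRes_sub_pencilRes {μ ν : ℝ} (hμ : IsUnit ((μ : ℂ) • P - L))
    (hν : IsUnit ((ν : ℂ) • P - L)) (x : H) :
    pencilRes P L μ x - pencilRes P L ν x =
      ((ν : ℂ) - μ) • pencilRes P L μ (pencilRes P L ν x) := by
  have h1 : x = ((μ : ℂ) • P (pencilInv P L ν x) - L (pencilInv P L ν x)) +
      ((ν : ℂ) - μ) • pencilRes P L ν x := by
    rw [apply_pencilInv hν, pencilRes_apply]
    module
  conv_lhs => rw [pencilRes_apply, h1, map_add, pencilInv_apply_sub hμ, map_smul, map_add, map_smul,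
    ← h1]
  rw [pencilRes_apply, pencilRes_apply, add_sub_cancel_left]

theorem pencilRes_comm {μ ν : ℝ} (hμ : IsUnit ((μ : ℂ) • P - L))
    (hν : IsUnit ((ν : ℂ) • P - L)) : Commute (pencilRes P L μ) (pencilRes P L ν) := by
  rcases eq_or_ne μ ν with rfl | hne
  · exact Commute.refl _
  · ext x
    have h1 := pencilRes_sub_pencilRes hμ hν x
    have h2 := pencilRes_sub_pencilRes hν hμ x
    have hne' : (ν : ℂ) - μ ≠ 0 := sub_ne_zero.2 (by exact_mod_cast hne.symm)
    have h3 : ((ν : ℂ) - μ) • (pencilRes P L μ (pencilRes P L ν x)) =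
        ((ν : ℂ) - μ) • (pencilRes P L ν (pencilRes P L μ x)) := by
      rw [← h1, ← neg_sub (pencilRes P L ν x), h2, ← neg_smul, neg_sub]
    exact smul_right_injective H hne' h3

/-- For `z` the resolvent applied to `x`, the energy bound gives `|μ| ‖z‖² ≤ ‖x‖ ‖z‖ + ω ‖z‖²`. The
term in `ω` is absorbed since `ω ≤ |μ| / 2`, at the price of the factor `2`. -/
theorem norm_pencilRes_le {ω : ℝ} (hω : ∀ w, |(⟪L w, P w⟫_ℂ).re| ≤ ω * ‖P w‖ ^ 2) {μ : ℝ}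
    (h : IsUnit ((μ : ℂ) • P - L)) (hμ : 2 * ω ≤ |μ|) (x : H) :
    |μ| * ‖pencilRes P L μ x‖ ≤ 2 * ‖x‖ := by
  set z := pencilRes P L μ x with hz
  have h1 := hω (pencilInv P L μ x)
  rw [apply_pencilInv h, ← pencilRes_apply, ← hz, inner_sub_left, Complex.sub_re,
    inner_smul_left, Complex.conj_ofReal, Complex.re_ofReal_mul,
    inner_self_eq_norm_sq_to_K] at h1
  norm_cast at h1
  simp only [Complex.coe_algebraMap] at h1
  norm_cast at h1
  have h2 : |(⟪x, z⟫_ℂ).re| ≤ ‖x‖ * ‖z‖ :=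
    (Complex.abs_re_le_norm _).trans (norm_inner_le_norm _ _)
  have h3 : |μ| * ‖z‖ ^ 2 ≤ ‖x‖ * ‖z‖ + ω * ‖z‖ ^ 2 := by
    have : |μ| * ‖z‖ ^ 2 = |μ * ‖z‖ ^ 2| := by
      rw [abs_mul, abs_of_nonneg (sq_nonneg ‖z‖)]
    rw [this]
    have h4 := abs_add_le (μ * ‖z‖ ^ 2 - (⟪x, z⟫_ℂ).re) (⟪x, z⟫_ℂ).re
    rw [sub_add_cancel] at h4
    linarith
  rcases (norm_nonneg z).eq_or_lt with h0 | h0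
  · rw [← h0]; simp
  · have h5 : |μ| * ‖z‖ ≤ ‖x‖ + ω * ‖z‖ := by
      refine le_of_mul_le_mul_right ?_ h0
      linarith
    nlinarith

/-- A Yosida approximation of `L P⁻¹` that is symmetric under time reversal. -/
def yosida (P L : H →L[ℂ] H) (μ : ℝ) : H →L[ℂ] H :=
  ((μ : ℂ) ^ 2 / 2) • (pencilRes P L μ + pencilRes P L (-μ))

/-- Let `G = L P⁻¹` and `y = -(μ² - G²)⁻¹ x`, `z = G y`. Then `x = G z - μ² y` and the approximation
maps `x` to `-μ² z`, so its quadratic form has real part `-μ² Re ⟪G z, z⟫ + μ⁴ Re ⟪G y, y⟫`. Both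
terms fall under the energy bound, and `‖z‖ ≤ 2 ‖x‖ / μ`, `‖y‖ ≤ 4 ‖x‖ / μ²` give the constant `20 =
2² + 4²`. -/
theorem abs_re_inner_yosida_le {ω : ℝ} (hω0 : 0 ≤ ω)
    (hω : ∀ w, |(⟪L w, P w⟫_ℂ).re| ≤ ω * ‖P w‖ ^ 2) {μ : ℝ}
    (h : IsUnit ((μ : ℂ) • P - L)) (h' : IsUnit (((-μ : ℝ) : ℂ) • P - L)) (hμ0 : 0 < μ)
    (hμ : 2 * ω ≤ μ) (x : H) : |(⟪yosida P L μ x, x⟫_ℂ).re| ≤ 20 * ω * ‖x‖ ^ 2 := by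
  set u := pencilRes P L μ x with hu
  set v := pencilRes P L (-μ) x with hv
  have hn : ∀ x, μ * ‖pencilRes P L μ x‖ ≤ 2 * ‖x‖ := fun x => by
    have := norm_pencilRes_le hω h (hμ.trans (le_abs_self μ)) x
    rwa [abs_of_pos hμ0] at this
  have hn' : ∀ x, μ * ‖pencilRes P L (-μ) x‖ ≤ 2 * ‖x‖ := fun x => by
    have := norm_pencilRes_le hω h' (by rw [abs_neg]; exact hμ.trans (le_abs_self μ)) x
    rwa [abs_neg, abs_of_pos hμ0] at this
  -- `w₁` and `w₂` are the preimages under `P` of `y` and `z`, so that `G y = L w₁` and `G z = L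
  -- w₂`.
  set w₁ := pencilInv P L μ v with hw₁
  set w₂ := (-(1 / 2) : ℂ) • (pencilInv P L μ x + pencilInv P L (-μ) x) with hw₂
  set y := P w₁ with hy
  set z := P w₂ with hz
  have hyd : u - v = (-2 * (μ : ℂ)) • y := by
    have := pencilRes_sub_pencilRes h h' x
    rw [hu, hv, this, hy, hw₁, ← pencilRes_apply]
    push_cast
    congr 1; ring
  have hzd : z = (-(1 / 2) : ℂ) • (u + v) := by
    rw [hz, hw₂, map_smul, map_add]; rfl
  have hL₁ : L w₁ = z := by
    rw [hw₁, apply_pencilInv h, pencilRes_apply, ← hw₁, ← hy, hzd]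
    have : (μ : ℂ) • y = (-(1 / 2) : ℂ) • (u - v) := by
      rw [hyd, smul_smul]; congr 1; ring
    rw [this]; module
  have hL₂ : L w₂ = x + ((μ : ℂ) ^ 2) • y := by
    have : ((μ : ℂ) ^ 2) • y = (-(μ : ℂ) / 2) • (u - v) := by
      rw [hyd, smul_smul]; congr 1; ring
    rw [this, hw₂, map_smul, map_add, apply_pencilInv h, apply_pencilInv h', ← hu, ← hv]
    push_cast
    module
  have hx : x = L w₂ - ((μ : ℂ) ^ 2) • y := by rw [hL₂, add_sub_cancel_right]
  have hM : yosida P L μ x = (-(μ : ℂ) ^ 2) • z := by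
    rw [hzd, smul_smul]
    change ((μ : ℂ) ^ 2 / 2) • (u + v) = _
    congr 1; ring
  have key : (⟪yosida P L μ x, x⟫_ℂ).re =
      -μ ^ 2 * (⟪L w₂, z⟫_ℂ).re + μ ^ 4 * (⟪L w₁, y⟫_ℂ).re := by
    have e : ∀ a : H, (⟪z, a⟫_ℂ).re = (⟪a, z⟫_ℂ).re := fun a => by
      rw [← inner_conj_symm, Complex.conj_re]
    have c1 : (-(μ : ℂ) ^ 2) = ((-μ ^ 2 : ℝ) : ℂ) := by push_cast; rfl
    have c2 : ((μ : ℂ) ^ 2) = ((μ ^ 2 : ℝ) : ℂ) := by push_cast; rfl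
    rw [hM]
    conv_lhs => rw [hx]
    rw [inner_smul_left, inner_sub_right, inner_smul_right, c1, c2, Complex.conj_ofReal,
      Complex.re_ofReal_mul, Complex.sub_re, Complex.re_ofReal_mul, e (L w₂), hL₁]
    ring
  have hzn : μ * ‖z‖ ≤ 2 * ‖x‖ := by
    rw [hzd, norm_smul]
    have : ‖(-(1 / 2) : ℂ)‖ = 1 / 2 := by norm_num
    rw [this]
    have h3 := norm_add_le u v
    nlinarith [hn x, hn' x]
  have hyn : μ ^ 2 * ‖y‖ ≤ 4 * ‖x‖ := by
    have h3 := hn v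
    rw [pencilRes_apply, ← hw₁, ← hy] at h3
    nlinarith [hn' x]
  rw [key]
  have b1 := hω w₂
  have b2 := hω w₁
  rw [← hz] at b1
  rw [← hy] at b2
  have b3 : (μ * ‖z‖) ^ 2 ≤ (2 * ‖x‖) ^ 2 := by gcongr
  have b4 : (μ ^ 2 * ‖y‖) ^ 2 ≤ (4 * ‖x‖) ^ 2 := by gcongr
  refine (abs_add_le _ _).trans ?_
  rw [abs_mul, abs_mul, abs_neg, abs_of_nonneg (sq_nonneg μ),
    abs_of_nonneg (by positivity : 0 ≤ μ ^ 4)]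
  calc μ ^ 2 * |(⟪L w₂, z⟫_ℂ).re| + μ ^ 4 * |(⟪L w₁, y⟫_ℂ).re|
      ≤ μ ^ 2 * (ω * ‖z‖ ^ 2) + μ ^ 4 * (ω * ‖y‖ ^ 2) := by gcongr
    _ = ω * ((μ * ‖z‖) ^ 2 + (μ ^ 2 * ‖y‖) ^ 2) := by ring
    _ ≤ ω * ((2 * ‖x‖) ^ 2 + (4 * ‖x‖) ^ 2) := by gcongr
    _ = _ := by ring

/-- On the range of the resolvent at `ν`, the approximation is the mean of the two operators `±μ (±μ
- G)⁻¹`, each tending strongly to `1`, applied to `G (ν - G)⁻¹ x`. -/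
theorem yosida_pencilRes {μ ν : ℝ} (h : IsUnit ((μ : ℂ) • P - L))
    (h' : IsUnit (((-μ : ℝ) : ℂ) • P - L)) (hν : IsUnit ((ν : ℂ) • P - L)) (x : H) :
    yosida P L μ (pencilRes P L ν x) =
      ((1 / 2 : ℂ) • ((μ : ℂ) • pencilRes P L μ + ((-μ : ℝ) : ℂ) • pencilRes P L (-μ)))
        ((ν : ℂ) • pencilRes P L ν x - x) := by
  have h1 := pencilRes_sub_pencilRes h hν x
  have h2 := pencilRes_sub_pencilRes h' hν x
  simp only [yosida, _root_.smul_apply, _root_.add_apply, map_sub, map_smul]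
  have e1 : pencilRes P L μ x = pencilRes P L ν x +
      ((ν : ℂ) - μ) • pencilRes P L μ (pencilRes P L ν x) := by rw [← h1]; abel
  have e2 : pencilRes P L (-μ) x = pencilRes P L ν x +
      ((ν : ℂ) - (-μ : ℝ)) • pencilRes P L (-μ) (pencilRes P L ν x) := by rw [← h2]; abel
  rw [e1, e2]
  push_cast
  module

/-- Generation theorem: the Cauchy problem `(P w)' = L w`, i.e. `x' = L P⁻¹ x`, has global
solutions in both time directions. -/
theorem exists_flow_of_isUnit_pencil [CompleteSpace H] {ω : ℝ}
    (hω : ∀ w, |(⟪L w, P w⟫_ℂ).re| ≤ ω * ‖P w‖ ^ 2) (hP : DenseRange P) {μ₀ : ℝ}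
    (hu : ∀ μ : ℝ, μ₀ < |μ| → IsUnit ((μ : ℂ) • P - L)) (w₀ : H) :
    ∃ w : ℝ → H, w 0 = w₀ ∧ ∀ t, HasDerivAt (fun s => P (w s)) (L (w t)) t := by
  set ω' := max ω 0
  have hω0 : 0 ≤ ω' := le_max_right _ _
  have hω' : ∀ w, |(⟪L w, P w⟫_ℂ).re| ≤ ω' * ‖P w‖ ^ 2 := fun w =>
    (hω w).trans (by gcongr; exact le_max_left _ _)
  -- Beyond `ν` in absolute value the pencil is invertible and the resolvent bound applies, for both
  -- signs of the parameter.
  set ν := |μ₀| + 2 * ω' + 1 with hν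
  set N : ℕ → ℝ := fun n => n + ν with hN
  have hNν : ∀ n, ν ≤ N n := fun n => le_add_of_nonneg_left n.cast_nonneg
  have hν1 : 0 < ν := by positivity
  have hN0 : ∀ n, 0 < N n := fun n => hν1.trans_le (hNν n)
  have hνu : ∀ μ, ν ≤ |μ| → IsUnit ((μ : ℂ) • P - L) := fun μ hμ => hu μ (by
    linarith [le_abs_self μ₀])
  have hR := hνu ν (le_abs_self ν)
  have hNu : ∀ n, IsUnit ((N n : ℂ) • P - L) := fun n => hνu _ ((hNν n).trans (le_abs_self _))
  have hNu' : ∀ n, IsUnit (((-N n : ℝ) : ℂ) • P - L) := fun n =>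
    hνu _ (by rw [abs_neg]; exact (hNν n).trans (le_abs_self _))
  have hN2 : ∀ n, 2 * ω' ≤ N n := fun n => by linarith [hNν n, abs_nonneg μ₀]
  -- `T` is the bounded operator `G (ν - G)⁻¹ = L (ν P - L)⁻¹`.
  set T : H →L[ℂ] H := (ν : ℂ) • pencilRes P L ν - 1 with hT
  have hTapply : ∀ x, T x = (ν : ℂ) • pencilRes P L ν x - x := fun x => rfl
  have hdense : DenseRange (pencilRes P L ν) := by
    refine hP.comp (Function.Surjective.denseRange fun w => ⟨_, pencilInv_apply_sub hR w⟩)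
      P.continuous
  have hcomm : ∀ n {κ : ℝ}, IsUnit ((κ : ℂ) • P - L) →
      Commute (yosida P L (N n)) (pencilRes P L κ) := fun n κ hκ =>
    ((pencilRes_comm (hNu n) hκ).add_left (pencilRes_comm (hNu' n) hκ)).smul_left _
  have hres : ∀ (s : ℕ → ℝ), (∀ n, |s n| = N n) → ∀ x,
      Tendsto (fun n => ((s n : ℂ) • pencilRes P L (s n)) x) atTop (𝓝 x) := by
    intro s hs
    have hsu : ∀ n, IsUnit ((s n : ℂ) • P - L) := fun n => hνu _ ((hs n).symm ▸ hNν n)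
    have hsb : ∀ n x, N n * ‖pencilRes P L (s n) x‖ ≤ 2 * ‖x‖ := fun n x => by
      have := norm_pencilRes_le hω' (hsu n) (by rw [hs]; exact hN2 n) x
      rwa [hs] at this
    refine tendsto_of_denseRange (C := 2) (fun n x => ?_) hdense fun y => ?_
    · rw [_root_.smul_apply, norm_smul, Complex.norm_real, Real.norm_eq_abs, hs]
      exact hsb n x
    · rw [tendsto_iff_norm_sub_tendsto_zero]
      have hb : ∀ n, ‖((s n : ℂ) • pencilRes P L (s n)) (pencilRes P L ν y) - pencilRes P L ν y‖
          ≤ 2 * ‖T y‖ / N n := fun n => by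
        have h1 := pencilRes_sub_pencilRes (hsu n) hR y
        -- `s (s - G)⁻¹ - 1 = (s - G)⁻¹ G`, which on the dense range of the resolvent at `ν` is of
        -- order `1 / |s|`.
        have h2 : ((s n : ℂ) • pencilRes P L (s n)) (pencilRes P L ν y) - pencilRes P L ν y
            = pencilRes P L (s n) (T y) := by
          rw [hTapply, map_sub, map_smul, _root_.smul_apply]
          have e1 : pencilRes P L (s n) y = pencilRes P L ν y +
            ((ν : ℂ) - s n) • pencilRes P L (s n) (pencilRes P L ν y) := by rw [← h1]; abel
          rw [e1]; module
        rw [h2, le_div_iff₀ (hN0 n), mul_comm]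
        exact hsb n _
      refine squeeze_zero (fun n => norm_nonneg _) hb ?_
      exact (tendsto_const_nhds).div_atTop
        (tendsto_atTop_add_const_right _ _ tendsto_natCast_atTop_atTop)
  obtain ⟨w, hw0, hw⟩ := exists_flow_of_tendsto (M := fun n => yosida P L (N n))
    (K := 20 * ω') (R := pencilRes P L ν) (T := T)
    (fun m n => ((hcomm m (hNu n)).add_right (hcomm m (hNu' n))).smul_right _) (by positivity)
    (fun n x => abs_re_inner_yosida_le hω0 hω' (hNu n) (hNu' n) (hN0 n) (hN2 n) x) hdense
    (fun n => hcomm n hR)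
    (fun n => ((hcomm n hR).smul_right _).sub_right (Commute.one_right _))
    (fun y => by
      have h1 := hres N (fun n => abs_of_pos (hN0 n)) (T y)
      have h2 := hres (fun n => -N n) (fun n => by rw [abs_neg, abs_of_pos (hN0 n)]) (T y)
      have h3 := (h1.add h2).const_smul (1 / 2 : ℂ)
      have h4 : (1 / 2 : ℂ) • (T y + T y) = T y := by module
      rw [h4] at h3
      refine h3.congr fun n => ?_
      rw [yosida_pencilRes (hNu n) (hNu' n) hR]
      rfl)
    -- The flow is started at `(ν P - L) w₀`, so that applying `(ν P - L)⁻¹` to it returns a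
    -- solution of the pencil equation starting at `w₀`.
    ((ν : ℂ) • P w₀ - L w₀)
  refine ⟨fun t => pencilInv P L ν (w t), ?_, fun t => ?_⟩
  · simp only [hw0]
    exact pencilInv_apply_sub hR w₀
  · have := hw t
    rw [hTapply, ← apply_pencilInv hR] at this
    exact this

/-- Solutions of `(P w)' = L w` are determined by their initial value. -/
theorem eq_zero_of_hasDerivAt_pencil {ω : ℝ}
    (hω : ∀ w, |(⟪L w, P w⟫_ℂ).re| ≤ ω * ‖P w‖ ^ 2) {w : ℝ → H}
    (hw : ∀ t, HasDerivAt (fun s => P (w s)) (L (w t)) t) (h0 : P (w 0) = 0) (t : ℝ) :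
    P (w t) = 0 := by
  have := norm_le_exp_abs_mul_of_abs_re_inner_le hw (fun t => hω (w t)) t
  rw [h0, norm_zero, mul_zero] at this
  exact norm_le_zero_iff.1 this

end Pencil
end AbstractWave

namespace AbstractWave

open scoped InnerProductSpace
open Filter Topology

/-! ### The wave pencil on `X ⊕ X`. -/

section PhaseSpace

variable {X : Type*} [NormedAddCommGroup X] [InnerProductSpace ℂ X]

/-- The bounded operator on `X ⊕ X` with components `f` and `g`. -/
def pairMap (f g : X × X →L[ℂ] X) : WithLp 2 (X × X) →L[ℂ] WithLp 2 (X × X) :=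
  (WithLp.prodContinuousLinearEquiv 2 ℂ X X).symm.toContinuousLinearMap ∘L (f.prod g) ∘L
    (WithLp.prodContinuousLinearEquiv 2 ℂ X X).toContinuousLinearMap

@[simp] theorem pairMap_fst (f g : X × X →L[ℂ] X) (w : WithLp 2 (X × X)) :
    (pairMap f g w).fst = f (w.fst, w.snd) := rfl

@[simp] theorem pairMap_snd (f g : X × X →L[ℂ] X) (w : WithLp 2 (X × X)) :
    (pairMap f g w).snd = g (w.fst, w.snd) := rfl

theorem pair_ext {v w : WithLp 2 (X × X)} (h₁ : v.fst = w.fst) (h₂ : v.snd = w.snd) : v = w :=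
  WithLp.ofLp_injective 2 (Prod.ext h₁ h₂)

theorem norm_fst_le (w : WithLp 2 (X × X)) : ‖w.fst‖ ≤ ‖w‖ :=
  (sq_le_sq₀ (norm_nonneg _) (norm_nonneg _)).1 (by
    rw [WithLp.prod_norm_sq_eq_of_L2]; exact le_add_of_nonneg_right (sq_nonneg _))

theorem norm_snd_le (w : WithLp 2 (X × X)) : ‖w.snd‖ ≤ ‖w‖ :=
  (sq_le_sq₀ (norm_nonneg _) (norm_nonneg _)).1 (by
    rw [WithLp.prod_norm_sq_eq_of_L2]; exact le_add_of_nonneg_left (sq_nonneg _))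

theorem pair_inner (v w : WithLp 2 (X × X)) :
    ⟪v, w⟫_ℂ = ⟪v.fst, w.fst⟫_ℂ + ⟪v.snd, w.snd⟫_ℂ := WithLp.prod_inner_apply v w

theorem hasDerivAt_pair {w : ℝ → WithLp 2 (X × X)} {w' : WithLp 2 (X × X)} {t : ℝ} :
    HasDerivAt w w' t ↔ HasDerivAt (fun s => (w s).fst) w'.fst t ∧
      HasDerivAt (fun s => (w s).snd) w'.snd t := by
  constructor
  · intro h
    exact ⟨((WithLp.fstL 2 ℂ X X).restrictScalars ℝ).hasFDerivAt.comp_hasDerivAt t h,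
      ((WithLp.sndL 2 ℂ X X).restrictScalars ℝ).hasFDerivAt.comp_hasDerivAt t h⟩
  · rintro ⟨h₁, h₂⟩
    exact (((WithLp.prodContinuousLinearEquiv 2 ℂ X
      X).symm.toContinuousLinearMap.restrictScalars ℝ).hasFDerivAt).comp_hasDerivAt t
        (h₁.prodMk h₂)

/-- `P ⊕ P`. -/
def diagMap (P : X →L[ℂ] X) : WithLp 2 (X × X) →L[ℂ] WithLp 2 (X × X) :=
  pairMap (P ∘L .fst ℂ X X) (P ∘L .snd ℂ X X)

variable (X) in
/-- The rotation `(a, b) ↦ (b, -a)`. -/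
def rotMap : WithLp 2 (X × X) →L[ℂ] WithLp 2 (X × X) :=
  pairMap (.snd ℂ X X) (-(.fst ℂ X X))

/-- The contribution `(a, b) ↦ (0, -i B b - C P a)` of the lower order terms. -/
def lowerMap (P B C : X →L[ℂ] X) : WithLp 2 (X × X) →L[ℂ] WithLp 2 (X × X) :=
  pairMap 0 (-((Complex.I • B) ∘L .snd ℂ X X) - (C ∘L P) ∘L .fst ℂ X X)

section

variable (P B C : X →L[ℂ] X) (w : WithLp 2 (X × X))

@[simp] theorem diagMap_fst : (diagMap P w).fst = P w.fst := rfl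
@[simp] theorem diagMap_snd : (diagMap P w).snd = P w.snd := rfl
@[simp] theorem rotMap_fst : (rotMap X w).fst = w.snd := rfl
@[simp] theorem rotMap_snd : (rotMap X w).snd = -w.fst := rfl
@[simp] theorem lowerMap_fst : (lowerMap P B C w).fst = 0 := rfl
@[simp] theorem lowerMap_snd :
    (lowerMap P B C w).snd = -(Complex.I • B w.snd) - C (P w.fst) := rfl

end

theorem norm_rotMap (w : WithLp 2 (X × X)) : ‖rotMap X w‖ ^ 2 = ‖w‖ ^ 2 := by
  rw [WithLp.prod_norm_sq_eq_of_L2, WithLp.prod_norm_sq_eq_of_L2, rotMap_fst, rotMap_snd,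
    norm_neg, add_comm]

theorem re_inner_diagMap_rotMap {P : X →L[ℂ] X} (hP : (P : X →ₗ[ℂ] X).IsSymmetric)
    (w : WithLp 2 (X × X)) : (⟪diagMap P w, rotMap X w⟫_ℂ).re = 0 := by
  have h : ⟪P w.snd, w.fst⟫_ℂ = ⟪w.snd, P w.fst⟫_ℂ := hP _ _
  rw [pair_inner, diagMap_fst, diagMap_snd, rotMap_fst, rotMap_snd, inner_neg_right, h,
    ← inner_conj_symm w.snd, Complex.add_re, Complex.neg_re, Complex.conj_re, add_neg_cancel]

/-- The cross term vanishes by symmetry of `P`, and the rotation is isometric. The identity controls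
both `‖w‖` and `|μ| ‖diagMap P w‖`, the two quantities that bound the lower order terms. -/
theorem norm_sq_smul_diagMap_sub_rotMap {P : X →L[ℂ] X} (hP : (P : X →ₗ[ℂ] X).IsSymmetric)
    (μ : ℝ) (w : WithLp 2 (X × X)) :
    ‖((μ : ℂ) • diagMap P - rotMap X) w‖ ^ 2 = (|μ| * ‖diagMap P w‖) ^ 2 + ‖w‖ ^ 2 := by
  rw [_root_.sub_apply, _root_.smul_apply, @norm_sub_sq ℂ, inner_smul_left, Complex.conj_ofReal,
    RCLike.re_eq_complex_re, Complex.re_ofReal_mul, re_inner_diagMap_rotMap hP, norm_rotMap,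
    norm_smul, Complex.norm_real, Real.norm_eq_abs]
  ring

theorem denseRange_diagMap {P : X →L[ℂ] X} (hP : DenseRange P) : DenseRange (diagMap P) := by
  have h := ((WithLp.prodContinuousLinearEquiv 2 ℂ X X).symm.surjective.denseRange).comp
    (hP.prodMap hP) (WithLp.prodContinuousLinearEquiv 2 ℂ X X).symm.continuous
  refine h.mono ?_
  rintro _ ⟨⟨a, b⟩, rfl⟩
  exact ⟨WithLp.toLp 2 (a, b), rfl⟩

variable [CompleteSpace X]

/-- The rotation `J` commutes with `D = diagMap P` and `J² = -1`, so `(μD - J)(μD + J) = 1 + (μD)² ≥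
1` is invertible. Commuting factors of an invertible product are invertible. -/
theorem isUnit_smul_diagMap_sub_rotMap {P : X →L[ℂ] X} (hP : (P : X →ₗ[ℂ] X).IsSymmetric)
    (μ : ℝ) : IsUnit ((μ : ℂ) • diagMap P - rotMap X) := by
  have hsa : IsSelfAdjoint ((μ : ℂ) • diagMap P) := by
    rw [ContinuousLinearMap.isSelfAdjoint_iff_isSymmetric]
    intro v w
    change ⟪(μ : ℂ) • diagMap P v, w⟫_ℂ = ⟪v, (μ : ℂ) • diagMap P w⟫_ℂ
    have h1 : ⟪P v.fst, w.fst⟫_ℂ = ⟪v.fst, P w.fst⟫_ℂ := hP _ _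
    have h2 : ⟪P v.snd, w.snd⟫_ℂ = ⟪v.snd, P w.snd⟫_ℂ := hP _ _
    rw [inner_smul_left, inner_smul_right, Complex.conj_ofReal, pair_inner, pair_inner,
      diagMap_fst, diagMap_snd, diagMap_fst, diagMap_snd, h1, h2]
  have hc : Commute (diagMap P) (rotMap X) := by
    ext1 w
    refine pair_ext ?_ ?_
    · rfl
    · exact map_neg P w.fst
  have hr : rotMap X * rotMap X = -1 := by
    ext1 w
    exact pair_ext rfl rfl
  have hc' : Commute ((μ : ℂ) • diagMap P) (rotMap X) := hc.smul_left _
  have h1 : ((μ : ℂ) • diagMap P - rotMap X) * ((μ : ℂ) • diagMap P + rotMap X) =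
      1 + ((μ : ℂ) • diagMap P) ^ 2 := by
    rw [sub_mul, mul_add, mul_add, hr, hc'.eq, sq]
    abel
  have h2 : IsUnit (1 + ((μ : ℂ) • diagMap P) ^ 2) :=
    CStarAlgebra.isUnit_of_le 1 (le_add_of_nonneg_right hsa.sq_nonneg) (by cfc_tac)
  rw [← h1, Commute.isUnit_mul_iff] at h2
  · exact h2.1
  · exact ((Commute.refl _).add_right hc').sub_left (hc'.symm.add_right (Commute.refl _))

/-- Neumann series for `N - F = (1 - F N⁻¹) N`. -/
theorem isUnit_sub_of_norm_le {H : Type*} [NormedAddCommGroup H] [NormedSpace ℂ H]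
    [CompleteSpace H] {N F : H →L[ℂ] H} (hN : IsUnit N) {q : ℝ} (hq0 : 0 ≤ q) (hq : q < 1)
    (hF : ∀ w, ‖F w‖ ≤ q * ‖N w‖) : IsUnit (N - F) := by
  have h1 : ‖F * Ring.inverse N‖ ≤ q := by
    refine ContinuousLinearMap.opNorm_le_bound _ hq0 fun x => ?_
    have h2 := hF (Ring.inverse N x)
    have h3 : N (Ring.inverse N x) = x :=
      congrArg (fun f : H →L[ℂ] H => f x) (Ring.mul_inverse_cancel _ hN)
    rwa [h3] at h2
  have h4 := (isUnit_one_sub_of_norm_lt_one (h1.trans_lt hq)).mul hN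
  rwa [sub_mul, one_mul, mul_assoc, Ring.inverse_mul_cancel _ hN, mul_one] at h4

theorem isUnit_wave_pencil {P B C : X →L[ℂ] X} (hP : (P : X →ₗ[ℂ] X).IsSymmetric) {a b : ℝ}
    (ha0 : 0 ≤ a) (ha : a < 1) (hB : ∀ x, ‖B x‖ ≤ a * ‖x‖ + |b| * ‖P x‖) {μ : ℝ}
    (hμ : (|b| + ‖C‖) / (1 - a) < |μ|) :
    IsUnit ((μ : ℂ) • diagMap P - (rotMap X + lowerMap P B C)) := by
  have hμ0 : 0 < |μ| := lt_of_le_of_lt (div_nonneg (by positivity) (by linarith)) hμ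
  rw [div_lt_iff₀ (by linarith)] at hμ
  rw [← sub_sub]
  -- The part of `B` of relative size `a` does not shrink as `|μ|` grows, hence the need for `a <
  -- 1`; the terms seen through `P` gain a factor `1 / |μ|`.
  refine isUnit_sub_of_norm_le (q := a + (|b| + ‖C‖) / |μ|) (isUnit_smul_diagMap_sub_rotMap hP μ)
    (by positivity) ?_ fun w => ?_
  · have : (|b| + ‖C‖) / |μ| < 1 - a := by rw [div_lt_iff₀ hμ0]; linarith
    linarith
  have h1 := norm_sq_smul_diagMap_sub_rotMap hP μ w
  set r := ‖((μ : ℂ) • diagMap P - rotMap X) w‖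
  have hr : 0 ≤ r := norm_nonneg _
  have h2 : ‖w‖ ≤ r := (sq_le_sq₀ (norm_nonneg _) hr).1 (by
    rw [h1]; exact le_add_of_nonneg_left (sq_nonneg _))
  have h3 : ‖diagMap P w‖ ≤ r / |μ| := by
    rw [le_div_iff₀ hμ0, mul_comm]
    exact (sq_le_sq₀ (by positivity) hr).1 (by rw [h1]; linarith [sq_nonneg ‖w‖])
  have h4 : ‖lowerMap P B C w‖ = ‖-(Complex.I • B w.snd) - C (P w.fst)‖ := by
    have := WithLp.prod_norm_sq_eq_of_L2 (lowerMap P B C w)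
    rw [lowerMap_fst, lowerMap_snd, norm_zero, zero_pow two_ne_zero, zero_add] at this
    exact (sq_eq_sq₀ (norm_nonneg _) (norm_nonneg _)).1 this
  have h5 : ‖P w.fst‖ ≤ ‖diagMap P w‖ := norm_fst_le (diagMap P w)
  have h6 : ‖P w.snd‖ ≤ ‖diagMap P w‖ := norm_snd_le (diagMap P w)
  calc ‖lowerMap P B C w‖ ≤ ‖B w.snd‖ + ‖C (P w.fst)‖ := by
        rw [h4]
        refine (norm_sub_le _ _).trans_eq ?_
        rw [norm_neg, norm_smul, Complex.norm_I, one_mul]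
    _ ≤ (a * ‖w.snd‖ + |b| * ‖P w.snd‖) + ‖C‖ * ‖P w.fst‖ := by
        gcongr
        · exact hB _
        · exact C.le_opNorm _
    _ ≤ (a * r + |b| * (r / |μ|)) + ‖C‖ * (r / |μ|) := by
        have := (norm_snd_le w).trans h2
        have := h5.trans h3
        have := h6.trans h3
        gcongr
    _ = _ := by ring

theorem abs_re_inner_wave_le {P B C : X →L[ℂ] X} (hP : (P : X →ₗ[ℂ] X).IsSymmetric) {K : ℝ}
    (hK : 0 ≤ K) (hB : ∀ x, |(⟪Complex.I • B x, P x⟫_ℂ).re| ≤ K * ‖P x‖ ^ 2)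
    (w : WithLp 2 (X × X)) :
    |(⟪(rotMap X + lowerMap P B C) w, diagMap P w⟫_ℂ).re| ≤ (K + ‖C‖) * ‖diagMap P w‖ ^ 2 := by
  have h0 : (⟪rotMap X w, diagMap P w⟫_ℂ).re = 0 := by
    rw [← inner_conj_symm, Complex.conj_re, re_inner_diagMap_rotMap hP]
  have h5 : ‖P w.fst‖ ≤ ‖diagMap P w‖ := norm_fst_le (diagMap P w)
  have h6 : ‖P w.snd‖ ≤ ‖diagMap P w‖ := norm_snd_le (diagMap P w)
  rw [_root_.add_apply, inner_add_left, Complex.add_re, h0, zero_add, pair_inner, lowerMap_fst,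
    lowerMap_snd, diagMap_snd, inner_zero_left, zero_add, inner_sub_left, inner_neg_left,
    Complex.sub_re, Complex.neg_re]
  refine (abs_sub _ _).trans ?_
  rw [abs_neg]
  have h7 : |(⟪C (P w.fst), P w.snd⟫_ℂ).re| ≤ ‖C‖ * ‖diagMap P w‖ ^ 2 := by
    refine (Complex.abs_re_le_norm _).trans ((norm_inner_le_norm _ _).trans ?_)
    rw [sq, ← mul_assoc]
    gcongr
    exact (C.le_opNorm _).trans (by gcongr)
  have h8 := hB w.snd
  have h9 : K * ‖P w.snd‖ ^ 2 ≤ K * ‖diagMap P w‖ ^ 2 := by gcongr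
  linarith

end PhaseSpace
end AbstractWave

namespace AbstractWave

open scoped InnerProductSpace
open Filter Topology

/-! ### Passage between the wave equation and the pencil equation. -/

section Translation

variable {X : Type*} [NormedAddCommGroup X] [InnerProductSpace ℂ X] [CompleteSpace X]
  {A : X →ₗ.[ℂ] X} {hA : StrictlyPositive A}

namespace EnergySpace

/-- `A^{1/2}` as an isometric isomorphism from `W₁` onto `X`. -/
def sqrtIso : EnergySpace A hA ≃ₗᵢ[ℂ] X :=
  LinearIsometryEquiv.ofSurjective
    { toLinearMap := sqrtMap (A := A) (hA := hA), norm_map' := fun x => (norm_def x).symm }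
    ((sqrt_spec A hA).surjective hA)

theorem sqrtIso_apply (x : EnergySpace A hA) : sqrtIso x = x.sqrtMap := rfl

theorem exists_sqrt_inverse (A : X →ₗ.[ℂ] X) (hA : StrictlyPositive A) :
    ∃ P : X →L[ℂ] X, (P : X →ₗ[ℂ] X).IsSymmetric ∧ DenseRange P ∧
      ∀ x : EnergySpace A hA, P x.sqrtMap = x.toX := by
  have hS := sqrt_spec A hA
  obtain ⟨P, hPs, -, hP⟩ := exists_inverse hS.isSelfAdjoint (hS.injective hA) (hS.surjective hA)
  exact ⟨P, hPs, hS.isSelfAdjoint.dense_domain.mono fun x hx => ⟨_, hP ⟨x, hx⟩⟩, hP⟩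

theorem sqrtMap_eq_apply {P : X →L[ℂ] X} (hP : ∀ x : EnergySpace A hA, P x.sqrtMap = x.toX)
    {x : EnergySpace A hA} (hx : x.toX ∈ A.domain) : P (A ⟨x.toX, hx⟩) = x.sqrtMap := by
  have hS := sqrt_spec A hA
  obtain ⟨h, h'⟩ := (hS.mem_domain_iff _).1 hx
  rw [← hS.apply_apply _ hx h h']
  exact hP ⟨_, h'⟩

/-- This recovers `u t ∈ D(A)`: since `P` maps into the domain of the square root, `A^{1/2} x = P a`
allows the square root to be applied once more. -/
theorem mem_domain_of_sqrtMap_eq {P : X →L[ℂ] X}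
    (hP : ∀ x : EnergySpace A hA, P x.sqrtMap = x.toX) {x : EnergySpace A hA} {a : X}
    (ha : x.sqrtMap = P a) : ∃ hx : x.toX ∈ A.domain, A ⟨x.toX, hx⟩ = a := by
  have hS := sqrt_spec A hA
  obtain ⟨z, rfl⟩ := (sqrtIso (A := A) (hA := hA)).surjective a
  rw [sqrtIso_apply, hP] at ha
  have h' : sqrt A hA ⟨x.toX, x.2⟩ ∈ (sqrt A hA).domain := by
    change x.sqrtMap ∈ _
    rw [ha]
    exact z.2
  have hx : x.toX ∈ A.domain := (hS.mem_domain_iff _).2 ⟨x.2, h'⟩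
  exact ⟨hx, (hS.apply_apply _ hx x.2 h').symm.trans (congrArg (sqrt A hA) (Subtype.ext ha))⟩

/-- `B'` is `B A^{-1/2}`. The quadratic bound becomes linear by `√(p² + q²) ≤ p + q`, which leaves
the relative constant `a` unchanged. -/
theorem exists_bounded_extension {P : X →L[ℂ] X}
    (hP : ∀ x : EnergySpace A hA, P x.sqrtMap = x.toX) (B : EnergySpace A hA →ₗ[ℂ] X) {a b : ℝ}
    (hB : ∀ x, ‖B x‖ ^ 2 ≤ a ^ 2 * ‖x.sqrtMap‖ ^ 2 + b ^ 2 * ‖x.toX‖ ^ 2) :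
    ∃ B' : X →L[ℂ] X, (∀ x, B' x.sqrtMap = B x) ∧ ∀ y, ‖B' y‖ ≤ |a| * ‖y‖ + |b| * ‖P y‖ := by
  have h1 : ∀ y, ‖B (sqrtIso.symm y)‖ ≤ |a| * ‖y‖ + |b| * ‖P y‖ := fun y => by
    have h2 := hB (sqrtIso.symm y)
    rw [← hP, ← sqrtIso_apply, LinearIsometryEquiv.apply_symm_apply] at h2
    refine (sq_le_sq₀ (norm_nonneg _) (by positivity)).1 (h2.trans ?_)
    have h3 : 0 ≤ |a| * ‖y‖ * (|b| * ‖P y‖) := by positivity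
    rw [← sq_abs a, ← sq_abs b]
    nlinarith
  refine ⟨(B ∘ₗ (sqrtIso (A := A) (hA := hA)).symm.toLinearEquiv.toLinearMap).mkContinuous
    (|a| + |b| * ‖P‖) fun y => (h1 y).trans ?_, fun x => ?_, h1⟩
  · rw [add_mul, mul_assoc]
    gcongr
    exact P.le_opNorm y
  · exact congrArg B ((sqrtIso (A := A) (hA := hA)).symm_apply_apply x)

end EnergySpace

variable {P B' C' : X →L[ℂ] X} {B C : EnergySpace A hA →ₗ[ℂ] X}

open EnergySpace

theorem hasDerivAt_diagMap_of_wave (hP : ∀ x : EnergySpace A hA, P x.sqrtMap = x.toX)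
    (hB : ∀ x, B' x.sqrtMap = B x) (hC : ∀ x, C' x.sqrtMap = C x)
    {u : ℝ → EnergySpace A hA} (hu : Differentiable ℝ u)
    (hu' : Differentiable ℝ (fun t => (deriv u t).toX)) (hd : ∀ t, (u t).toX ∈ A.domain)
    (heq : ∀ t, deriv (fun s => (deriv u s).toX) t + Complex.I • B (deriv u t)
          + (A ⟨(u t).toX, hd t⟩ + C (u t)) = 0) (t : ℝ) :
    HasDerivAt (fun s => diagMap P (WithLp.toLp 2 (A ⟨(u s).toX, hd s⟩, (deriv u s).sqrtMap)))
      ((rotMap X + lowerMap P B' C')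
        (WithLp.toLp 2 (A ⟨(u t).toX, hd t⟩, (deriv u t).sqrtMap))) t := by
  rw [hasDerivAt_pair]
  constructor
  · have h1 := ((sqrtIso (A := A) (hA := hA)).toContinuousLinearEquiv.toContinuousLinearMap.restrictScalars
        ℝ).hasFDerivAt.comp_hasDerivAt t (hu t).hasDerivAt
    have h2 : (fun s => (diagMap P (WithLp.toLp 2
        (A ⟨(u s).toX, hd s⟩, (deriv u s).sqrtMap))).fst) = fun s => (u s).sqrtMap :=
      funext fun s => sqrtMap_eq_apply hP (hd s)
    have h3 : ((rotMap X + lowerMap P B' C')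
        (WithLp.toLp 2 (A ⟨(u t).toX, hd t⟩, (deriv u t).sqrtMap))).fst = (deriv u t).sqrtMap :=
      add_zero _
    rw [h2, h3]
    exact h1
  · have h1 := (hu' t).hasDerivAt
    have h2 : (fun s => (diagMap P (WithLp.toLp 2
        (A ⟨(u s).toX, hd s⟩, (deriv u s).sqrtMap))).snd) = fun s => (deriv u s).toX :=
      funext fun s => hP _
    have h3 : ((rotMap X + lowerMap P B' C')
        (WithLp.toLp 2 (A ⟨(u t).toX, hd t⟩, (deriv u t).sqrtMap))).snd =
          -A ⟨(u t).toX, hd t⟩ +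
            (-(Complex.I • B' (deriv u t).sqrtMap) - C' (P (A ⟨(u t).toX, hd t⟩))) := rfl
    have h4 : deriv (fun s => (deriv u s).toX) t = -A ⟨(u t).toX, hd t⟩ +
        (-(Complex.I • B (deriv u t)) - C (u t)) := by
      have := heq t
      rw [add_assoc] at this
      rw [eq_neg_of_add_eq_zero_left this]
      abel
    rw [h2, h3, sqrtMap_eq_apply hP, hB, hC, ← h4]
    exact h1

theorem wave_of_hasDerivAt_diagMap (hP : ∀ x : EnergySpace A hA, P x.sqrtMap = x.toX)
    (hB : ∀ x, B' x.sqrtMap = B x) (hC : ∀ x, C' x.sqrtMap = C x) {w : ℝ → WithLp 2 (X × X)}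
    (hw : ∀ t, HasDerivAt (fun s => diagMap P (w s)) ((rotMap X + lowerMap P B' C') (w t)) t) :
    ∃ u : ℝ → EnergySpace A hA, (∀ t, (u t).sqrtMap = P (w t).fst) ∧
      (∀ t, (deriv u t).sqrtMap = (w t).snd) ∧ Differentiable ℝ u ∧
      Differentiable ℝ (fun t => (deriv u t).toX) ∧
      ∀ t : ℝ, ∃ h : (u t).toX ∈ A.domain,
        deriv (fun s => (deriv u s).toX) t + Complex.I • B (deriv u t)
          + (A ⟨(u t).toX, h⟩ + C (u t)) = 0 := by
  set e := sqrtIso (A := A) (hA := hA)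
  set u : ℝ → EnergySpace A hA := fun t => e.symm (P (w t).fst) with hu
  have hSu : ∀ t, (u t).sqrtMap = P (w t).fst := fun t => e.apply_symm_apply _
  have hd : ∀ t, HasDerivAt u (e.symm (w t).snd) t := fun t => by
    have h1 := (hasDerivAt_pair.1 (hw t)).1
    have h3 : ((rotMap X + lowerMap P B' C') (w t)).fst = (w t).snd := add_zero _
    rw [h3] at h1
    exact (e.symm.toContinuousLinearEquiv.toContinuousLinearMap.restrictScalars
      ℝ).hasFDerivAt.comp_hasDerivAt t h1
  have hSd : ∀ t, (deriv u t).sqrtMap = (w t).snd := fun t => by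
    rw [(hd t).deriv]; exact e.apply_symm_apply _
  have hX : (fun t => (deriv u t).toX) = fun t => P (w t).snd := funext fun t => by
    rw [← hP, hSd]
  have hd2 : ∀ t, HasDerivAt (fun t => (deriv u t).toX)
      (-(w t).fst + (-(Complex.I • B' (w t).snd) - C' (P (w t).fst))) t := fun t => by
    rw [hX]
    exact (hasDerivAt_pair.1 (hw t)).2
  refine ⟨u, hSu, hSd, fun t => (hd t).differentiableAt, fun t => (hd2 t).differentiableAt,
    fun t => ?_⟩
  obtain ⟨h, h'⟩ := mem_domain_of_sqrtMap_eq hP (hSu t)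
  refine ⟨h, ?_⟩
  rw [(hd2 t).deriv, h', ← hSd, ← hSu, hB, hC]
  abel

/-- The only use of the alternative on `B`: if `B` is symmetric then `⟪B x, x⟫` is real and `i B`
contributes no energy, so `K = 0`; if `B` is bounded, Cauchy–Schwarz suffices. -/
theorem exists_abs_re_inner_le (hP : ∀ x : EnergySpace A hA, P x.sqrtMap = x.toX)
    (hB : ∀ x, B' x.sqrtMap = B x)
    (h : (∀ x y : EnergySpace A hA, ⟪B x, y.toX⟫_ℂ = ⟪x.toX, B y⟫_ℂ) ∨
      ∃ K : ℝ, ∀ x : EnergySpace A hA, ‖B x‖ ≤ K * ‖x.toX‖) :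
    ∃ K : ℝ, 0 ≤ K ∧ ∀ y, |(⟪Complex.I • B' y, P y⟫_ℂ).re| ≤ K * ‖P y‖ ^ 2 := by
  have hs := (sqrtIso (A := A) (hA := hA)).surjective
  rcases h with h | ⟨K, hK⟩
  · refine ⟨0, le_rfl, fun y => ?_⟩
    obtain ⟨x, rfl⟩ := hs y
    have h1 : (⟪B x, x.toX⟫_ℂ).im = 0 := by
      have h2 := h x x
      rw [← inner_conj_symm x.toX] at h2
      exact Complex.conj_eq_iff_im.1 h2.symm
    rw [sqrtIso_apply, hB, hP, inner_smul_left]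
    simp [h1]
  · refine ⟨|K|, abs_nonneg K, fun y => ?_⟩
    obtain ⟨x, rfl⟩ := hs y
    rw [sqrtIso_apply, hB, hP]
    refine (Complex.abs_re_le_norm _).trans ((norm_inner_le_norm _ _).trans ?_)
    rw [norm_smul, Complex.norm_I, one_mul, sq, ← mul_assoc]
    gcongr
    exact (hK x).trans (by gcongr; exact le_abs_self K)

end Translation

end AbstractWave

end
-- Existence and uniqueness for the wave equation.
open scoped InnerProductSpace in
theorem theorem11 {X : Type*} [NormedAddCommGroup X] [InnerProductSpace ℂ X] [CompleteSpace X]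
    (A : X →ₗ.[ℂ] X) (hA : AbstractWave.StrictlyPositive A)
    (B : AbstractWave.EnergySpace A hA →ₗ[ℂ] X)
    (hB : ∃ a b : ℝ, 0 ≤ a ∧ a < 1 ∧ ∀ x : AbstractWave.EnergySpace A hA,
      ‖B x‖ ^ 2 ≤ a ^ 2 * ‖x.sqrtMap‖ ^ 2 + b ^ 2 * ‖x.toX‖ ^ 2)
    (hB' : (∀ x y : AbstractWave.EnergySpace A hA, ⟪B x, y.toX⟫_ℂ = ⟪x.toX, B y⟫_ℂ) ∨
      ∃ K : ℝ, ∀ x : AbstractWave.EnergySpace A hA, ‖B x‖ ≤ K * ‖x.toX‖)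
    (C : AbstractWave.EnergySpace A hA →ₗ[ℂ] X)
    (hC : ∃ c d : ℝ, ∀ x : AbstractWave.EnergySpace A hA,
      ‖C x‖ ^ 2 ≤ c ^ 2 * ‖x.sqrtMap‖ ^ 2 + d ^ 2 * ‖x.toX‖ ^ 2)
    (t₀ : ℝ) (ξ : A.domain) (η : AbstractWave.EnergySpace A hA) :
    ∃! u : ℝ → AbstractWave.EnergySpace A hA,
      Differentiable ℝ u ∧ (u t₀).toX = (ξ : X) ∧ deriv u t₀ = η ∧
      Differentiable ℝ (fun t => (deriv u t).toX) ∧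
      ∀ t : ℝ, ∃ h : (u t).toX ∈ A.domain,
        deriv (fun s => (deriv u s).toX) t + Complex.I • B (deriv u t)
          + (A ⟨(u t).toX, h⟩ + C (u t)) = 0 := by
  obtain ⟨P, hPs, hPd, hP⟩ := AbstractWave.EnergySpace.exists_sqrt_inverse A hA
  obtain ⟨a, b, ha0, ha, hab⟩ := hB
  obtain ⟨c, d, hcd⟩ := hC
  obtain ⟨B₁, hB₁, hB₁b⟩ := AbstractWave.EnergySpace.exists_bounded_extension hP B hab
  obtain ⟨C₁, hC₁, -⟩ := AbstractWave.EnergySpace.exists_bounded_extension hP C hcd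
  obtain ⟨K, hK, hKb⟩ := AbstractWave.exists_abs_re_inner_le hP hB₁ hB'
  rw [abs_of_nonneg ha0] at hB₁b
  have hω := AbstractWave.abs_re_inner_wave_le (C := C₁) hPs hK hKb
  have hSinj := (AbstractWave.EnergySpace.sqrtIso (A := A) (hA := hA)).injective
  have hSξ : ∃ x : AbstractWave.EnergySpace A hA, x.toX = (ξ : X) :=
    ⟨⟨ξ, (((AbstractWave.sqrt_spec A hA).mem_domain_iff _).1 ξ.2).1⟩, rfl⟩
  obtain ⟨x₀, hx₀⟩ := hSξ
  refine existsUnique_of_exists_of_unique ?_ ?_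
  · obtain ⟨w, hw0, hw⟩ := AbstractWave.exists_flow_of_isUnit_pencil hω
      (AbstractWave.denseRange_diagMap hPd)
      (fun μ hμ => AbstractWave.isUnit_wave_pencil hPs ha0 ha hB₁b hμ)
      -- The value of `(A u, A^{1/2} u')` at the initial time. The equation is autonomous, so the
      -- flow from time `0` is shifted by `t₀`.
      (WithLp.toLp 2 (A ξ, η.sqrtMap))
    obtain ⟨u, hu₁, hu₂, hu₃, hu₄, hu₅⟩ := AbstractWave.wave_of_hasDerivAt_diagMap hP hB₁ hC₁
      (w := fun t => w (t - t₀)) (fun t => (hw (t - t₀)).comp_sub_const t t₀)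
    refine ⟨u, hu₃, ?_, ?_, hu₄, hu₅⟩
    · rw [← hx₀]
      congr 1
      refine hSinj ?_
      have hx₀d : x₀.toX ∈ A.domain := hx₀ ▸ ξ.2
      have h1 : A ⟨x₀.toX, hx₀d⟩ = A ξ := congrArg A (Subtype.ext hx₀)
      have h2 := hu₁ t₀
      rw [sub_self, hw0] at h2
      change (u t₀).sqrtMap = x₀.sqrtMap
      rw [h2, ← AbstractWave.EnergySpace.sqrtMap_eq_apply hP hx₀d, h1]
      rfl
    · refine hSinj ?_
      have h2 := hu₂ t₀
      rw [sub_self, hw0] at h2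
      exact h2
  · rintro u v ⟨hu₁, hu₂, hu₃, hu₄, hu₅⟩ ⟨hv₁, hv₂, hv₃, hv₄, hv₅⟩
    choose hud hue using hu₅
    choose hvd hve using hv₅
    have hu := AbstractWave.hasDerivAt_diagMap_of_wave hP hB₁ hC₁ hu₁ hu₄ hud hue
    have hv := AbstractWave.hasDerivAt_diagMap_of_wave hP hB₁ hC₁ hv₁ hv₄ hvd hve
    set p : ℝ → WithLp 2 (X × X) :=
      fun t => WithLp.toLp 2 (A ⟨(u t).toX, hud t⟩, (deriv u t).sqrtMap)
    set q : ℝ → WithLp 2 (X × X) :=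
      fun t => WithLp.toLp 2 (A ⟨(v t).toX, hvd t⟩, (deriv v t).sqrtMap)
    have h0 : p t₀ = q t₀ := by
      have h1 : A ⟨(u t₀).toX, hud t₀⟩ = A ⟨(v t₀).toX, hvd t₀⟩ :=
        congrArg A (Subtype.ext (hu₂.trans hv₂.symm))
      simp only [p, q, h1, hu₃, hv₃]
    have hz := AbstractWave.eq_zero_of_hasDerivAt_pencil hω (w := fun t => p (t + t₀) - q (t + t₀))
      (fun t => by
        have h1 := ((hu (t + t₀)).comp_add_const t t₀).sub ((hv (t + t₀)).comp_add_const t t₀)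
        simp only [map_sub]
        exact h1)
      (by simp only [zero_add, h0, sub_self, map_zero])
    funext t
    refine hSinj ?_
    -- The energy estimate only makes the image under `diagMap P` vanish. Its first component is the
    -- difference of `A^{1/2} u` and `A^{1/2} v`, so injectivity of `A^{1/2}` finishes.
    have h1 := hz (t - t₀)
    rw [sub_add_cancel, map_sub, sub_eq_zero] at h1
    have h2 := congrArg (fun w : WithLp 2 (X × X) => w.fst) h1
    have h3 := AbstractWave.EnergySpace.sqrtMap_eq_apply hP (hud t)
    have h4 := AbstractWave.EnergySpace.sqrtMap_eq_apply hP (hvd t)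
    exact h3.symm.trans (h2.trans h4)
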